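/- An embedding of a finite graph $G$ into a graph $H$ is an injective map $f:V(G)\to V(H)$ together with, for every edge $e=xy$ of $G$, a path $P_f(e)$ in $H$ (not necessarily a shortest one) between $f(x)$ and $f(y)$. Its wirelength is the sum of the lengths of the paths $P_f(e)$ over all $e\in E(G)$, and the wirelength $WL(G,H)$ is the minimum of the wirelengths of all embeddings of $G$ into $H$. Let $n\ge 3$, let $1\le r_1\le r_2\le\cdots\le r_n$ be integers, put $r=r_1+\cdots+r_n$, and let $p\ge 1$ be an integer with $p\le r-r_n$ (equivalently, $2^p$ divides $2^{r-r_i}$ for every $i$). Let $G=K_{2^{r-p},\ldots,2^{r-p}}$ be the complete $2^p$-partite graph with all parts of size $2^{r-p}$, and let $H$ be the $n$-dimensional cylinder $C_{2^{r_1}}\,\square\,P_{2^{r_2}}\,\square\cdots\square\,P_{2^{r_n}}$, the Cartesian product of a cycle on $2^{r_1}$ vertices and paths on $2^{r_2},\ldots,2^{r_n}$ vertices (for $r_1=1$, $C_2$ stands for a single edge $K_2$). Then $G$ has an embedding into $H$, and $$WL(G,H)=\frac{2^{2r-p}(2^p-1)}{6}\left[\sum_{i=2}^{n}2^{r_i}-\sum_{i=2}^{n}\frac{1}{2^{r_i}}\right]+(2^p-1)\,2^{2r+r_1-p-3}.$$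 -/

import Mathlib

namespace GraphWirelength

/-- The Cartesian product of a finite family of graphs: two tuples are adjacent when they are
adjacent in exactly one coordinate and agree in all the others. -/
def cartesianProduct {ι : Type*} {V : ι → Type*} (G : ∀ i, SimpleGraph (V i)) :
    SimpleGraph (∀ i, V i) where
  Adj x y := ∃ i, (G i).Adj (x i) (y i) ∧ ∀ j, j ≠ i → x j = y j
  symm := by
    constructor
    rintro x y ⟨i, h, h'⟩
    exact ⟨i, h.symm, fun j hj => (h' j hj).symm⟩
  loopless := by
    constructor
    rintro x ⟨i, h, -⟩
    exact (G i).loopless.irrefl _ h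

/-- The cylinder `C_{2^{r_1}} □ P_{2^{r_2}} □ ⋯ □ P_{2^{r_n}}`; the index `1` of the usual
notation is `0 : Fin n` here. -/
def cylinder {n : ℕ} (r : Fin n → ℕ) : SimpleGraph (∀ i : Fin n, Fin (2 ^ r i)) :=
  cartesianProduct fun i =>
    if i.val = 0 then SimpleGraph.cycleGraph (2 ^ r i) else SimpleGraph.pathGraph (2 ^ r i)

/-- An embedding of a guest graph `G` into a host graph `H`: an injective map on the vertices,
together with a path in `H` (not necessarily a shortest one) for every edge `e = xy` of `G`,
joining the images of `x` and `y`. -/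
structure Embedding {V W : Type*} (G : SimpleGraph V) (H : SimpleGraph W) where
  /-- the map on vertices -/
  toFun : V → W
  injective : Function.Injective toFun
  /-- one end of the path assigned to an edge -/
  source : G.edgeSet → W
  /-- the other end of the path assigned to an edge -/
  target : G.edgeSet → W
  ends : ∀ e : G.edgeSet, s(source e, target e) = Sym2.map toFun e.1
  /-- the path assigned to an edge -/
  path : ∀ e : G.edgeSet, H.Path (source e) (target e)

/-- The wirelength of one embedding: the sum, over the edges of the guest, of the lengths of the
paths assigned to them. -/
noncomputable def Embedding.wirelength {V W : Type*} [Finite V] {G : SimpleGraph V}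
    {H : SimpleGraph W} (f : Embedding G H) : ℕ :=
  ∑ᶠ e : G.edgeSet, (f.path e).1.length

/-- The wirelength `WL(G, H)`: the minimum of the wirelength over all embeddings of `G` into `H`
(a minimum whenever there is an embedding, as it is an infimum of natural numbers). -/
noncomputable def wirelength {V W : Type*} [Finite V] (G : SimpleGraph V) (H : SimpleGraph W) : ℕ :=
  sInf (Set.range fun f : Embedding G H => f.wirelength)

end GraphWirelength

namespace GraphWirelength

open Finset

/-! The distance in the cylinder counts separating cuts: initial segments for a path factor,
half-cycles for the cycle. So the wirelength is at least the sum, over all cuts, of the number of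
guest edges crossing the cut, with equality when every edge is routed along a geodesic
(`sum_adj_prodDist_le`, `exists_embedding_of_injective`).

Guest and host have the same number `N` of vertices, so an embedding is bijective on vertices and a
cut pulls back to a set of fixed size `S`. If this set meets the `P = 2 ^ p` parts in `t_k` points,
then `(N / P) * (P - 1) * S - S ^ 2 + ∑ t_k ^ 2` edges cross it. By Cauchy–Schwarz this is at least
`(1 - 1 / P) * S * (N - S)`, with equality when all `t_k` agree (`le_sum_cut_equipartite`,
`sum_cut_equipartite_of_balanced`).

One placement balances all cuts at once (`exists_balanced`): the parts are the cosets of a binary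
linear code that projects onto every coordinate block. Summing `S * (N - S)` over the cuts gives the
formula. -/

/-- The number of cuts, out of a finite family, that separate two points. -/
def cutDist {V : Type*} (s : Finset ℕ) (χ : ℕ → V → Bool) (x y : V) : ℕ :=
  #{c ∈ s | χ c x ≠ χ c y}

theorem cutDist_self {V : Type*} (s : Finset ℕ) (χ : ℕ → V → Bool) (x : V) :
    cutDist s χ x x = 0 := by
  simp [cutDist]

theorem cutDist_comm {V : Type*} (s : Finset ℕ) (χ : ℕ → V → Bool) (x y : V) :
    cutDist s χ x y = cutDist s χ y x := by
  simp only [cutDist, ne_comm]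

theorem cutDist_triangle {V : Type*} (s : Finset ℕ) (χ : ℕ → V → Bool) (x y z : V) :
    cutDist s χ x z ≤ cutDist s χ x y + cutDist s χ y z := by
  classical
  unfold cutDist
  refine (card_le_card ?_).trans (card_union_le _ _)
  intro c
  simp only [mem_filter, mem_union]
  rintro ⟨hc, h⟩
  by_cases h' : χ c x = χ c y
  · exact Or.inr ⟨hc, h' ▸ h⟩
  · exact Or.inl ⟨hc, h'⟩

/-- The cuts of a finite family realise the distance of a graph. -/
structure IsCutMetric {V : Type*} (Γ : SimpleGraph V) (s : Finset ℕ) (χ : ℕ → V → Bool) :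
    Prop where
  adj_le : ∀ x y, Γ.Adj x y → cutDist s χ x y ≤ 1
  step : ∀ x z, x ≠ z → ∃ y, Γ.Adj x y ∧ cutDist s χ y z + 1 ≤ cutDist s χ x z

/-! ### Distance in a Cartesian product. -/

section Product

variable {ι : Type*} [Fintype ι] {V : ι → Type*} {Γ : ∀ i, SimpleGraph (V i)}
  {s : ι → Finset ℕ} {χ : ∀ i, ℕ → V i → Bool}

/-- The sum over the coordinates of the cut distances. -/
def prodDist (s : ι → Finset ℕ) (χ : ∀ i, ℕ → V i → Bool) (x y : ∀ i, V i) : ℕ :=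
  ∑ i, cutDist (s i) (χ i) (x i) (y i)

theorem prodDist_comm (x y : ∀ i, V i) : prodDist s χ x y = prodDist s χ y x := by
  simp only [prodDist, cutDist_comm]

theorem prodDist_le_one (h : ∀ i, IsCutMetric (Γ i) (s i) (χ i)) {x y : ∀ i, V i}
    (hxy : (cartesianProduct Γ).Adj x y) : prodDist s χ x y ≤ 1 := by
  obtain ⟨i, hi, hj⟩ := hxy
  unfold prodDist
  rw [Finset.sum_eq_single i]
  · exact (h i).adj_le _ _ hi
  · intro j _ hne
    rw [hj j hne, cutDist_self]
  · simp

theorem prodDist_le_length (h : ∀ i, IsCutMetric (Γ i) (s i) (χ i)) {x y : ∀ i, V i}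
    (w : (cartesianProduct Γ).Walk x y) : prodDist s χ x y ≤ w.length := by
  induction w with
  | nil => simp [prodDist, cutDist_self]
  | @cons x y z hxy w ih =>
    have h1 := prodDist_le_one h hxy
    have h2 : prodDist s χ x z ≤ prodDist s χ x y + prodDist s χ y z := by
      unfold prodDist
      rw [← Finset.sum_add_distrib]
      exact Finset.sum_le_sum fun i _ => cutDist_triangle _ _ _ _ _
    rw [SimpleGraph.Walk.length_cons]
    omega

/-- Greedy descent: in any coordinate where the endpoints differ, `step` supplies an edge that
lowers the total distance. -/
theorem exists_walk_length_le (h : ∀ i, IsCutMetric (Γ i) (s i) (χ i)) (k : ℕ) :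
    ∀ x y : ∀ i, V i, prodDist s χ x y ≤ k →
      ∃ w : (cartesianProduct Γ).Walk x y, w.length ≤ k := by
  classical
  induction k with
  | zero =>
    intro x y hk
    have hxy : x = y := by
      funext i
      by_contra hne
      obtain ⟨z, -, hz⟩ := (h i).step _ _ hne
      have : cutDist (s i) (χ i) (x i) (y i) ≤ prodDist s χ x y :=
        Finset.single_le_sum (f := fun i => cutDist (s i) (χ i) (x i) (y i))
          (fun _ _ => Nat.zero_le _) (mem_univ i)
      omega
    subst hxy
    exact ⟨.nil, le_rfl⟩
  | succ k ih =>
    intro x y hk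
    by_cases hxy : x = y
    · subst hxy
      exact ⟨.nil, Nat.zero_le _⟩
    obtain ⟨i, hi⟩ := Function.ne_iff.mp hxy
    obtain ⟨z, hz, hd⟩ := (h i).step _ _ hi
    have hadj : (cartesianProduct Γ).Adj x (Function.update x i z) :=
      ⟨i, by simpa using hz, fun j hj => by simp [hj]⟩
    have hlt : prodDist s χ (Function.update x i z) y < prodDist s χ x y := by
      refine Finset.sum_lt_sum (fun j _ => ?_) ⟨i, mem_univ i, ?_⟩
      · by_cases hj : j = i
        · subst hj
          simp only [Function.update_self]
          omega
        · simp [hj]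
      · simp only [Function.update_self]
        omega
    obtain ⟨w, hw⟩ := ih (Function.update x i z) y (by omega)
    exact ⟨.cons hadj w, by simpa using hw⟩

theorem exists_path_length_eq (h : ∀ i, IsCutMetric (Γ i) (s i) (χ i)) (x y : ∀ i, V i) :
    ∃ w : (cartesianProduct Γ).Path x y, w.1.length = prodDist s χ x y := by
  classical
  obtain ⟨w, hw⟩ := exists_walk_length_le h _ x y le_rfl
  exact ⟨w.toPath, le_antisymm ((SimpleGraph.Walk.length_bypass_le_length w).trans hw)
    (prodDist_le_length h _)⟩

end Product

/-! ### Cut metrics of paths and even cycles. -/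

section Factors

/-- The initial segments of a path as cuts. -/
def pathCut (N : ℕ) (c : ℕ) (x : Fin N) : Bool := decide (x.val ≤ c)

theorem cutDist_pathCut {N : ℕ} (x y : Fin N) :
    cutDist (range (N - 1)) (pathCut N) x y = (x.val - y.val) + (y.val - x.val) := by
  have : {c ∈ range (N - 1) | pathCut N c x ≠ pathCut N c y}
      = Ico (min x.val y.val) (max x.val y.val) := by
    ext c
    simp only [pathCut, mem_filter, mem_range, mem_Ico, ne_eq, decide_eq_decide]
    omega
  rw [cutDist, this, Nat.card_Ico]
  omega

theorem isCutMetric_path (N : ℕ) :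
    IsCutMetric (SimpleGraph.pathGraph N) (range (N - 1)) (pathCut N) where
  adj_le x y h := by
    rw [SimpleGraph.pathGraph_adj] at h
    rw [cutDist_pathCut]
    omega
  step x z h := by
    have hne : x.val ≠ z.val := fun h' => h (Fin.ext h')
    rcases lt_or_gt_of_ne hne with hlt | hlt
    · refine ⟨⟨x.val + 1, by omega⟩, ?_, ?_⟩
      · rw [SimpleGraph.pathGraph_adj]
        exact Or.inl rfl
      · simp only [cutDist_pathCut]
        omega
    · refine ⟨⟨x.val - 1, by omega⟩, ?_, ?_⟩
      · rw [SimpleGraph.pathGraph_adj]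
        simp only
        omega
      · simp only [cutDist_pathCut]
        omega

/-- The half-cycles, starting at the vertices of the first half, as cuts. -/
def cycleCut (M N : ℕ) (c : ℕ) (x : Fin N) : Bool := decide (c ≤ x.val ∧ x.val < c + M)

/-- Half-cycles starting at `c` and `c + M` are complementary, so the starts `c < M` give every cut
once. -/
theorem cutDist_cycleCut {M N : ℕ} (hN : N = 2 * M) (x y : Fin N) :
    cutDist (range M) (cycleCut M N) x y =
      min ((x.val - y.val) + (y.val - x.val)) (N - ((x.val - y.val) + (y.val - x.val))) := by
  wlog hxy : x.val ≤ y.val generalizing x y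
  · rw [cutDist_comm, this y x (by omega), add_comm]
  by_cases hy : y.val < M
  · have : {c ∈ range M | cycleCut M N c x ≠ cycleCut M N c y} = Ico (x.val + 1) (y.val + 1) := by
      ext c
      simp only [cycleCut, mem_filter, mem_range, mem_Ico, ne_eq, decide_eq_decide]
      omega
    rw [cutDist, this, Nat.card_Ico]
    omega
  by_cases hx : x.val < M
  -- Passing from `y` to its antipode `y - M` flips every cut, so the cuts separating `x` from `y`
  -- are those not separating `x` from `y - M`.
  · have : {c ∈ range M | cycleCut M N c x ≠ cycleCut M N c y} =
        range M \ Ico (min x.val (y.val - M) + 1) (max x.val (y.val - M) + 1) := by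
      ext c
      simp only [cycleCut, mem_filter, mem_range, mem_Ico, ne_eq, decide_eq_decide, mem_sdiff]
      omega
    rw [cutDist, this, card_sdiff_of_subset, Nat.card_Ico, card_range]
    · omega
    · intro c
      simp only [mem_range, mem_Ico]
      omega
  · have : {c ∈ range M | cycleCut M N c x ≠ cycleCut M N c y} =
        Ico (x.val - M + 1) (y.val - M + 1) := by
      ext c
      simp only [cycleCut, mem_filter, mem_range, mem_Ico, ne_eq, decide_eq_decide]
      omega
    rw [cutDist, this, Nat.card_Ico]
    omega

/-- For `N = 2` the wrap-around clauses repeat the ordinary ones, so `C_2` as a single edge needs no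
separate treatment. -/
theorem cycleGraph_adj_iff_val {N : ℕ} (hN : 2 ≤ N) (x y : Fin N) :
    (SimpleGraph.cycleGraph N).Adj x y ↔
      x.val + 1 = y.val ∨ y.val + 1 = x.val ∨ (x.val = 0 ∧ y.val + 1 = N) ∨
        (y.val = 0 ∧ x.val + 1 = N) := by
  obtain ⟨k, rfl⟩ := Nat.exists_eq_add_of_le' hN
  rw [SimpleGraph.cycleGraph_adj']
  simp only [Fin.sub_def]
  have hx := x.isLt
  have hy := y.isLt
  have key : ∀ a b : ℕ, a < k + 2 → b < k + 2 →
      ((k + 2 - b + a) % (k + 2) = 1 ↔ b + 1 = a ∨ (a = 0 ∧ b + 1 = k + 2)) := by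
    intro a b ha hb
    rcases le_or_gt b a with h | h
    · rw [show k + 2 - b + a = (a - b) + (k + 2) by omega, Nat.add_mod_right,
        Nat.mod_eq_of_lt (by omega)]
      omega
    · rw [Nat.mod_eq_of_lt (by omega)]
      omega
  rw [key _ _ hx hy, key _ _ hy hx]
  omega

theorem isCutMetric_cycle {M N : ℕ} (hM : 1 ≤ M) (hN : N = 2 * M) :
    IsCutMetric (SimpleGraph.cycleGraph N) (range M) (cycleCut M N) where
  adj_le x y h := by
    rw [cycleGraph_adj_iff_val (by omega)] at h
    rw [cutDist_cycleCut hN]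
    omega
  step x z h := by
    have hne : x.val ≠ z.val := fun h' => h (Fin.ext h')
    -- The second hypothesis says that the increasing arc from `x` to `z` is a shortest one; `down`
    -- treats the other arc.
    have up : ∀ y : Fin N, (x.val + 1 = y.val ∨ (y.val = 0 ∧ x.val + 1 = N)) →
        ((x.val < z.val ∧ z.val - x.val ≤ M) ∨ (z.val < x.val ∧ M ≤ x.val - z.val)) →
        cutDist (range M) (cycleCut M N) y z + 1 ≤ cutDist (range M) (cycleCut M N) x z := by
      intro y hy hz
      simp only [cutDist_cycleCut hN]
      omega
    have down : ∀ y : Fin N, (y.val + 1 = x.val ∨ (x.val = 0 ∧ y.val + 1 = N)) →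
        ((z.val < x.val ∧ x.val - z.val ≤ M) ∨ (x.val < z.val ∧ M ≤ z.val - x.val)) →
        cutDist (range M) (cycleCut M N) y z + 1 ≤ cutDist (range M) (cycleCut M N) x z := by
      intro y hy hz
      simp only [cutDist_cycleCut hN]
      omega
    by_cases hc : (x.val < z.val ∧ z.val - x.val ≤ M) ∨ (z.val < x.val ∧ M ≤ x.val - z.val)
    · obtain ⟨y, hy⟩ : ∃ y : Fin N, x.val + 1 = y.val ∨ (y.val = 0 ∧ x.val + 1 = N) := by
        by_cases hl : x.val + 1 = N
        · exact ⟨⟨0, by omega⟩, Or.inr ⟨rfl, hl⟩⟩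
        · exact ⟨⟨x.val + 1, by omega⟩, Or.inl rfl⟩
      refine ⟨y, ?_, up y hy hc⟩
      rw [cycleGraph_adj_iff_val (by omega)]
      omega
    · obtain ⟨y, hy⟩ : ∃ y : Fin N, y.val + 1 = x.val ∨ (x.val = 0 ∧ y.val + 1 = N) := by
        by_cases hl : x.val = 0
        · exact ⟨⟨N - 1, by omega⟩, Or.inr ⟨hl, by simp only; omega⟩⟩
        · exact ⟨⟨x.val - 1, by omega⟩, Or.inl (by simp only; omega)⟩
      refine ⟨y, ?_, down y hy (by omega)⟩
      rw [cycleGraph_adj_iff_val (by omega)]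
      omega

end Factors

/-! ### Wirelength as a sum over ordered pairs. -/

section Edges

variable {V : Type*} [Fintype V] (G : SimpleGraph V) [DecidableRel G.Adj]

/-- Both sides sum over darts, two of which lie over each edge. -/
theorem sum_adj_eq_two_mul_sum_edgeSet [Fintype G.edgeSet] (F : Sym2 V → ℕ) :
    ∑ u, ∑ v, (if G.Adj u v then F s(u, v) else 0) = 2 * ∑ e : G.edgeSet, F e.1 := by
  classical
  have h1 : ∑ d : G.Dart, F d.edge = 2 * ∑ e : G.edgeSet, F e.1 := by
    rw [← Finset.sum_fiberwise_of_maps_to (s := univ) (t := G.edgeFinset)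
      (g := fun d : G.Dart => d.edge) (fun d _ => by simp [d.edge_mem])]
    rw [Finset.mul_sum, ← Finset.sum_coe_sort G.edgeFinset]
    refine Fintype.sum_equiv (Equiv.subtypeEquivRight fun e => by simp) _ _ fun e => ?_
    rw [Finset.sum_congr rfl (g := fun _ => F e.1)
      (fun d hd => by rw [(Finset.mem_filter.mp hd).2]), Finset.sum_const,
      G.dart_edge_fiber_card _ (SimpleGraph.mem_edgeFinset.mp e.2)]
    rfl
  rw [← h1, ← Fintype.sum_prod_type' (f := fun u v => if G.Adj u v then F s(u, v) else 0),
    ← Finset.sum_filter, eq_comm]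
  refine Finset.sum_bij (fun d _ => d.toProd) ?_ ?_ ?_ ?_
  · intro d _
    simp [d.adj]
  · intro a _ b _ h
    exact SimpleGraph.Dart.ext _ _ h
  · intro p hp
    exact ⟨⟨p, by simpa using hp⟩, mem_univ _, rfl⟩
  · intro d _
    rfl

variable {ι : Type*} [Fintype ι] {W : ι → Type*} {Γ : ∀ i, SimpleGraph (W i)}
  {s : ι → Finset ℕ} {χ : ∀ i, ℕ → W i → Bool}

/-- The product distance as a function on unordered pairs. -/
def prodDistSym2 (s : ι → Finset ℕ) (χ : ∀ i, ℕ → W i → Bool) : Sym2 (∀ i, W i) → ℕ :=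
  Sym2.lift ⟨prodDist s χ, prodDist_comm⟩

theorem sum_adj_prodDist_le (h : ∀ i, IsCutMetric (Γ i) (s i) (χ i))
    (f : Embedding G (cartesianProduct Γ)) :
    ∑ u, ∑ v, (if G.Adj u v then prodDist s χ (f.toFun u) (f.toFun v) else 0) ≤
      2 * f.wirelength := by
  classical
  rw [show ∑ u, ∑ v, (if G.Adj u v then prodDist s χ (f.toFun u) (f.toFun v) else 0) =
    2 * ∑ e : G.edgeSet, prodDistSym2 s χ (e.1.map f.toFun) from
    sum_adj_eq_two_mul_sum_edgeSet G fun e => prodDistSym2 s χ (e.map f.toFun)]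
  rw [Embedding.wirelength, finsum_eq_sum_of_fintype]
  refine Nat.mul_le_mul_left _ (Finset.sum_le_sum fun e _ => ?_)
  rw [← f.ends e]
  exact prodDist_le_length h _

theorem exists_embedding_of_injective (h : ∀ i, IsCutMetric (Γ i) (s i) (χ i))
    {φ : V → ∀ i, W i} (hφ : Function.Injective φ) :
    ∃ f : Embedding G (cartesianProduct Γ), 2 * f.wirelength =
      ∑ u, ∑ v, (if G.Adj u v then prodDist s χ (φ u) (φ v) else 0) := by
  classical
  choose P hP using exists_path_length_eq h
  let f : Embedding G (cartesianProduct Γ) :=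
    { toFun := φ
      injective := hφ
      -- An arbitrary orientation of each edge; the length of the geodesic does not depend on it.
      source := fun e => φ e.1.out.1
      target := fun e => φ e.1.out.2
      ends := fun e => by
        conv_rhs => rw [← Quot.out_eq e.1]
        rfl
      path := fun e => P _ _ }
  refine ⟨f, ?_⟩
  rw [show ∑ u, ∑ v, (if G.Adj u v then prodDist s χ (φ u) (φ v) else 0) =
    2 * ∑ e : G.edgeSet, prodDistSym2 s χ (e.1.map φ) from
    sum_adj_eq_two_mul_sum_edgeSet G fun e => prodDistSym2 s χ (e.map φ)]
  rw [Embedding.wirelength, finsum_eq_sum_of_fintype]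
  congr 1
  refine Finset.sum_congr rfl fun e _ => ?_
  rw [← f.ends e]
  exact hP _ _

end Edges

/-! ### Edges of an equipartite graph across a cut. -/

section Cuts

variable {α β : Type*} [Fintype α] [Fintype β] [DecidableEq α]

/-- The number of edges of a complete equipartite graph crossing a cut, counted twice. -/
theorem sum_cut_equipartite (g : α × β → ℝ) (hg : ∀ u, g u ^ 2 = g u) :
    ∑ u : α × β, ∑ v : α × β, (if u.1 ≠ v.1 then (g u - g v) ^ 2 else 0) =
      2 * Fintype.card β * (Fintype.card α - 1) * ∑ u, g u -
        2 * ((∑ u, g u) ^ 2 - ∑ k, (∑ y, g (k, y)) ^ 2) := by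
  have hF : ∀ k l, ∑ y, ∑ z, (g (k, y) - g (l, z)) ^ 2 =
      Fintype.card β * (∑ y, g (k, y)) + Fintype.card β * (∑ y, g (l, y)) -
        2 * ((∑ y, g (k, y)) * ∑ y, g (l, y)) := by
    intro k l
    have : ∀ y z, (g (k, y) - g (l, z)) ^ 2 = g (k, y) + g (l, z) - 2 * (g (k, y) * g (l, z)) := by
      intro y z
      linear_combination hg (k, y) + hg (l, z)
    simp only [this, Finset.sum_sub_distrib, Finset.sum_add_distrib, Finset.sum_const,
      ← Finset.mul_sum, ← Finset.sum_mul, card_univ, nsmul_eq_mul]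
  have hsplit : ∑ u : α × β, ∑ v : α × β, (if u.1 ≠ v.1 then (g u - g v) ^ 2 else 0) =
      ∑ k, ∑ l, (if k ≠ l then ∑ y, ∑ z, (g (k, y) - g (l, z)) ^ 2 else 0) := by
    simp only [Fintype.sum_prod_type]
    refine Finset.sum_congr rfl fun k _ => ?_
    rw [Finset.sum_comm]
    refine Finset.sum_congr rfl fun l _ => ?_
    split_ifs <;> simp
  have hdiag : ∀ F : α → α → ℝ, ∑ k, ∑ l, (if k ≠ l then F k l else 0) =
      ∑ k, ∑ l, F k l - ∑ k, F k k := by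
    intro F
    rw [← Finset.sum_sub_distrib]
    refine Finset.sum_congr rfl fun k _ => ?_
    have hk : ∑ l, (if k = l then F k l else 0) = F k k := by simp
    rw [eq_sub_iff_add_eq, ← hk, ← Finset.sum_add_distrib]
    refine Finset.sum_congr rfl fun l _ => ?_
    by_cases h : k = l <;> simp [h]
  rw [hsplit, hdiag]
  simp only [hF, Finset.sum_sub_distrib, Finset.sum_add_distrib, Finset.sum_const,
      ← Finset.mul_sum, ← Finset.sum_mul, card_univ, nsmul_eq_mul, Fintype.sum_prod_type, ← sq]
  ring

/-- Cauchy–Schwarz for the numbers of cut points in the parts; the bound sees only the total. -/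
theorem le_sum_cut_equipartite [Nonempty α] (g : α × β → ℝ) (hg : ∀ u, g u ^ 2 = g u) :
    2 * (1 - 1 / Fintype.card α) * ((∑ u, g u) *
        ((Fintype.card α * Fintype.card β : ℝ) - ∑ u, g u)) ≤
      ∑ u : α × β, ∑ v : α × β, (if u.1 ≠ v.1 then (g u - g v) ^ 2 else 0) := by
  rw [sum_cut_equipartite g hg]
  have hcs := sq_sum_le_card_mul_sum_sq (s := univ) (f := fun k => ∑ y, g (k, y))
  rw [← Fintype.sum_prod_type, card_univ] at hcs
  have hP : (0 : ℝ) < Fintype.card α := by exact_mod_cast Fintype.card_pos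
  have hcs' : (∑ u, g u) ^ 2 / Fintype.card α ≤ ∑ k, (∑ y, g (k, y)) ^ 2 := by
    rw [div_le_iff₀ hP]
    linarith
  have e : 2 * (1 - 1 / (Fintype.card α : ℝ)) * ((∑ u, g u) *
        ((Fintype.card α * Fintype.card β : ℝ) - ∑ u, g u)) =
      2 * Fintype.card β * (Fintype.card α - 1) * ∑ u, g u -
        2 * ((∑ u, g u) ^ 2 - (∑ u, g u) ^ 2 / Fintype.card α) := by
    field_simp
  rw [e]
  linarith

theorem sum_cut_equipartite_of_balanced [Nonempty α] (g : α × β → ℝ) (hg : ∀ u, g u ^ 2 = g u)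
    (σ : ℝ) (hσ : ∀ k, ∑ y, g (k, y) = σ) :
    ∑ u : α × β, ∑ v : α × β, (if u.1 ≠ v.1 then (g u - g v) ^ 2 else 0) =
    2 * (1 - 1 / Fintype.card α) * ((∑ u, g u) *
        ((Fintype.card α * Fintype.card β : ℝ) - ∑ u, g u)) := by
  rw [sum_cut_equipartite g hg]
  have hP : (Fintype.card α : ℝ) ≠ 0 := by exact_mod_cast Fintype.card_ne_zero
  have hS : ∑ u, g u = Fintype.card α * σ := by
    simp [Fintype.sum_prod_type, hσ]
  simp only [hσ, hS, Finset.sum_const, card_univ, nsmul_eq_mul]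
  field_simp

end Cuts

/-! ### Sums of functions of one coordinate. -/

section Product

variable {ι : Type*} [Fintype ι] [DecidableEq ι] {W : ι → Type*} [∀ i, Fintype (W i)]

theorem card_mul_sum_coordinate (i : ι) (h : W i → ℝ) :
    Fintype.card (W i) * ∑ x : ∀ j, W j, h (x i) =
      Fintype.card (∀ j, W j) * ∑ a, h a := by
  have e : ∑ x : ∀ j, W j, h (x i) =
      ∑ p : W i × (∀ j : {j // j ≠ i}, W j), h p.1 :=
    Fintype.sum_equiv (Equiv.piSplitAt i W) _ _ fun x => rfl
  rw [e, Fintype.card_congr (Equiv.piSplitAt i W), Fintype.card_prod, Fintype.sum_prod_type]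
  simp only [Finset.sum_const, card_univ, nsmul_eq_mul, ← Finset.mul_sum]
  push_cast
  ring

end Product

/-! ### A placement balanced in every coordinate. -/

section Bits

/-- Restriction along `g` is a surjective homomorphism, so its fibres are equinumerous. -/
theorem card_filter_comp_eq {A B : Type*} [Fintype A] [DecidableEq A] [Fintype B]
    [DecidableEq B] {g : A → B} (hg : Function.Injective g) (w : A → ZMod 2) :
    #{y : B → ZMod 2 | y ∘ g = w} * 2 ^ Fintype.card A = 2 ^ Fintype.card B := by
  let F : (B → ZMod 2) →+ (A → ZMod 2) :=
    { toFun := fun y => y ∘ g, map_zero' := rfl, map_add' := fun _ _ => rfl }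
  have hF : Function.Surjective F := hg.surjective_comp_right
  have hfib : ∀ v : A → ZMod 2, #{y | F y = v} = #{y | F y = w} := fun v =>
    AddMonoidHom.card_fiber_eq_of_mem_range F (hF v) (hF w)
  have h := Finset.card_eq_sum_card_fiberwise (f := F) (s := univ) (t := univ)
    (fun _ _ => by simp)
  simp only [hfib, Finset.sum_const, card_univ, Fintype.card_fun, ZMod.card, smul_eq_mul] at h
  rw [h, mul_comm]
  rfl

/-- Write host vertices as bit strings of length `p + q`, in blocks of length `r i`. The code
repeats `q` free bits cyclically; a block of at most `q` consecutive positions sees distinct free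
bits, so every coset is equidistributed on it. The cosets are the `2 ^ p` parts. -/
theorem exists_balanced {n : ℕ} (r : Fin n → ℕ) {p q : ℕ} (hpq : ∑ i, r i = p + q)
    (hq : ∀ i, r i ≤ q) (hq0 : 0 < q) :
    ∃ φ : Fin (2 ^ p) × Fin (2 ^ q) → ∀ i, Fin (2 ^ r i), Function.Bijective φ ∧
      ∀ k i a, #{y | φ (k, y) i = a} * 2 ^ r i = 2 ^ q := by
  classical
  let e := finSigmaFinEquiv (n := r)
  let c : (Σ i, Fin (r i)) → Fin q := fun b => ⟨(e b).val % q, Nat.mod_lt _ hq0⟩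
  have hc : Function.Surjective c := fun b =>
    ⟨e.symm ⟨b.val, by omega⟩, by
      apply Fin.ext
      simp [c, Nat.mod_eq_of_lt b.isLt]⟩
  have hinj : ∀ i, Function.Injective fun j : Fin (r i) => c ⟨i, j⟩ := by
    intro i j j' h
    have h' := congrArg Fin.val h
    simp only [c, e, finSigmaFinEquiv_apply] at h'
    have h2 : j.val % q = j'.val % q := Nat.ModEq.add_left_cancel' _ h'
    rw [Nat.mod_eq_of_lt (j.isLt.trans_le (hq i)), Nat.mod_eq_of_lt (j'.isLt.trans_le (hq i))] at h2
    exact Fin.ext h2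
  let T : (Fin q → ZMod 2) →+ ((Σ i, Fin (r i)) → ZMod 2) :=
    { toFun := fun y => y ∘ c, map_zero' := rfl, map_add' := fun _ _ => rfl }
  have hT : Function.Injective T := hc.injective_comp_right
  have hcard : Nat.card (((Σ i, Fin (r i)) → ZMod 2) ⧸ T.range) = 2 ^ p := by
    have h := AddSubgroup.card_eq_card_quotient_mul_card_addSubgroup T.range
    rw [← Nat.card_congr (AddMonoidHom.ofInjective hT).toEquiv] at h
    simp only [Nat.card_eq_fintype_card, Fintype.card_fun, ZMod.card, Fintype.card_sigma,
      Fintype.card_fin, hpq, pow_add] at h ⊢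
    exact (Nat.eq_of_mul_eq_mul_right (by positivity) h).symm
  let κ : Fin (2 ^ p) ≃ ((Σ i, Fin (r i)) → ZMod 2) ⧸ T.range :=
    (Finite.equivFinOfCardEq hcard).symm
  let η : Fin (2 ^ q) ≃ (Fin q → ZMod 2) := (Fintype.equivFinOfCardEq (by simp)).symm
  let ψ : ∀ i, (Fin (r i) → ZMod 2) ≃ Fin (2 ^ r i) := fun i =>
    Fintype.equivFinOfCardEq (by simp)
  let φ : Fin (2 ^ p) × Fin (2 ^ q) → ∀ i, Fin (2 ^ r i) := fun u i =>
    ψ i fun j => ((κ u.1).out + T (η u.2)) ⟨i, j⟩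
  refine ⟨φ, (Fintype.bijective_iff_injective_and_card φ).mpr ⟨?_, ?_⟩, ?_⟩
  · rintro ⟨k, y⟩ ⟨k', y'⟩ h
    have h1 : (κ k).out + T (η y) = (κ k').out + T (η y') := by
      funext ⟨i, j⟩
      exact congrFun ((ψ i).injective (congrFun h i)) j
    have h2 : κ k = κ k' := by
      have h3 := congrArg (QuotientAddGroup.mk (s := T.range)) h1
      have hmem : ∀ y, T y ∈ T.range := fun y => ⟨y, rfl⟩
      rw [QuotientAddGroup.mk_add_of_mem _ (hmem _), QuotientAddGroup.mk_add_of_mem _ (hmem _),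
        QuotientAddGroup.out_eq', QuotientAddGroup.out_eq'] at h3
      exact h3
    rw [h2] at h1
    rw [κ.injective h2, η.injective (hT (add_left_cancel h1))]
  · simp [Finset.prod_pow_eq_pow_sum, hpq, pow_add]
  · intro k i a
    -- Prescribing block `i` within coset `k` prescribes the code word there, shifted by the coset
    -- representative.
    have h := card_filter_comp_eq (hinj i) fun j => (ψ i).symm a j - (κ k).out ⟨i, j⟩
    rw [Fintype.card_fin, Fintype.card_fin] at h
    refine Eq.trans ?_ h
    congr 1
    refine Finset.card_equiv η fun y => ?_
    simp only [mem_filter, mem_univ, true_and, φ, ← Equiv.eq_symm_apply, funext_iff,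
      Function.comp_apply, Pi.add_apply, eq_sub_iff_add_eq']
    rfl

end Bits

/-! ### Summation over all cuts. -/

section Total

/-- The indicator of a Boolean, as a real number. -/
def boolReal (b : Bool) : ℝ := if b then 1 else 0

theorem boolReal_sq (b : Bool) : boolReal b ^ 2 = boolReal b := by
  cases b <;> simp [boolReal]

theorem cutDist_eq_sum {V : Type*} (s : Finset ℕ) (χ : ℕ → V → Bool) (x y : V) :
    (cutDist s χ x y : ℝ) = ∑ c ∈ s, (boolReal (χ c x) - boolReal (χ c y)) ^ 2 := by
  rw [cutDist, Finset.card_filter]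
  push_cast
  refine Finset.sum_congr rfl fun c _ => ?_
  cases χ c x <;> cases χ c y <;> simp [boolReal]

/-- The number of separated pairs of points, summed over the cuts and divided by the square of
the number of points. -/
noncomputable def cutDensity {V : Type*} [Fintype V] (s : Finset ℕ) (χ : ℕ → V → Bool) : ℝ :=
  ∑ c ∈ s, (∑ a, boolReal (χ c a)) * (Fintype.card V - ∑ a, boolReal (χ c a)) /
    (Fintype.card V : ℝ) ^ 2

variable {α β : Type*} [Fintype α] [Fintype β] {ι : Type*} [Fintype ι] {W : ι → Type*} {s : ι → Finset ℕ} {χ : ∀ i, ℕ → W i → Bool}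

theorem sum_prodDist_eq [DecidableEq α] (φ : α × β → ∀ i, W i) :
    ((∑ u : α × β, ∑ v : α × β, (if u.1 ≠ v.1 then prodDist s χ (φ u) (φ v) else 0) : ℕ) : ℝ) =
      ∑ i, ∑ c ∈ s i, ∑ u : α × β, ∑ v : α × β, (if u.1 ≠ v.1 then
        (boolReal (χ i c (φ u i)) - boolReal (χ i c (φ v i))) ^ 2 else 0) := by
  have : ∀ u v : α × β, (if u.1 ≠ v.1 then (prodDist s χ (φ u) (φ v) : ℝ) else 0) =
      ∑ i, ∑ c ∈ s i, (if u.1 ≠ v.1 then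
        (boolReal (χ i c (φ u i)) - boolReal (χ i c (φ v i))) ^ 2 else 0) := by
    intro u v
    split_ifs
    · simp [prodDist, cutDist_eq_sum]
    · simp
  push_cast
  simp only [this]
  rw [Finset.sum_congr rfl fun u _ => Finset.sum_comm, Finset.sum_comm]
  refine Finset.sum_congr rfl fun i _ => ?_
  rw [Finset.sum_congr rfl fun u _ => Finset.sum_comm, Finset.sum_comm]

variable [DecidableEq ι] [∀ i, Fintype (W i)] [∀ i, Nonempty (W i)]

/-- A coordinate takes each value equally often, so under a bijection the pulled-back cut has the
same proportion of points as in its factor, whatever `φ` is. -/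
theorem cut_term_eq {φ : α × β → ∀ i, W i} (hφ : Function.Bijective φ) (i : ι) (c : ℕ) :
    (∑ u, boolReal (χ i c (φ u i))) * ((Fintype.card α * Fintype.card β : ℝ) -
        ∑ u, boolReal (χ i c (φ u i))) =
      (Fintype.card α * Fintype.card β : ℝ) ^ 2 * ((∑ a, boolReal (χ i c a)) *
        (Fintype.card (W i) - ∑ a, boolReal (χ i c a)) / (Fintype.card (W i) : ℝ) ^ 2) := by
  have hW : (Fintype.card (W i) : ℝ) ≠ 0 := by exact_mod_cast Fintype.card_ne_zero
  have hN : (Fintype.card α * Fintype.card β : ℝ) = Fintype.card (∀ i, W i) := by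
    rw [← Fintype.card_of_bijective hφ, Fintype.card_prod]
    push_cast
    rfl
  have h1 : ∑ u, boolReal (χ i c (φ u i)) = ∑ x : ∀ i, W i, boolReal (χ i c (x i)) :=
    Fintype.sum_bijective φ hφ _ _ fun _ => rfl
  have h2 := card_mul_sum_coordinate i fun a => boolReal (χ i c a)
  rw [← h1, ← hN, mul_comm, ← eq_div_iff hW] at h2
  rw [h2]
  field_simp

variable [DecidableEq α] [Nonempty α]

theorem le_sum_prodDist {φ : α × β → ∀ i, W i} (hφ : Function.Bijective φ) :
    2 * ((1 - 1 / Fintype.card α) * (Fintype.card α * Fintype.card β : ℝ) ^ 2 *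
        ∑ i, cutDensity (s i) (χ i)) ≤
      ((∑ u : α × β, ∑ v : α × β,
        (if u.1 ≠ v.1 then prodDist s χ (φ u) (φ v) else 0) : ℕ) : ℝ) := by
  rw [sum_prodDist_eq, Finset.mul_sum, Finset.mul_sum]
  refine Finset.sum_le_sum fun i _ => ?_
  rw [cutDensity, Finset.mul_sum, Finset.mul_sum]
  refine Finset.sum_le_sum fun c _ => ?_
  refine le_trans (le_of_eq ?_)
    (le_sum_cut_equipartite (fun u => boolReal (χ i c (φ u i))) fun _ => boolReal_sq _)
  rw [cut_term_eq hφ]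
  ring

theorem sum_prodDist_of_balanced [∀ i, DecidableEq (W i)] {φ : α × β → ∀ i, W i}
    (hφ : Function.Bijective φ)
    (hb : ∀ k i a, #{y | φ (k, y) i = a} * Fintype.card (W i) = Fintype.card β) :
    ((∑ u : α × β, ∑ v : α × β,
        (if u.1 ≠ v.1 then prodDist s χ (φ u) (φ v) else 0) : ℕ) : ℝ) =
      2 * ((1 - 1 / Fintype.card α) * (Fintype.card α * Fintype.card β : ℝ) ^ 2 *
        ∑ i, cutDensity (s i) (χ i)) := by
  rw [sum_prodDist_eq, Finset.mul_sum, Finset.mul_sum]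
  refine Finset.sum_congr rfl fun i _ => ?_
  rw [cutDensity, Finset.mul_sum, Finset.mul_sum]
  refine Finset.sum_congr rfl fun c _ => ?_
  have hW : (Fintype.card (W i) : ℝ) ≠ 0 := by exact_mod_cast Fintype.card_ne_zero
  rw [sum_cut_equipartite_of_balanced (fun u => boolReal (χ i c (φ u i))) (fun _ => boolReal_sq _)
    -- Each part places `card β / card (W i)` points over every value of coordinate `i`.
    (Fintype.card β / Fintype.card (W i) * ∑ a, boolReal (χ i c a)), cut_term_eq hφ]
  · ring
  · intro k
    rw [← Finset.sum_fiberwise_of_maps_to (s := univ) (t := univ) (g := fun y => φ (k, y) i)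
      (fun _ _ => mem_univ _), Finset.mul_sum]
    refine Finset.sum_congr rfl fun a _ => ?_
    rw [Finset.sum_congr rfl (g := fun _ => boolReal (χ i c a))
      (fun y hy => by rw [(Finset.mem_filter.mp hy).2]), Finset.sum_const, nsmul_eq_mul,
      ← hb k i a]
    push_cast
    field_simp

end Total

/-! ### Cut densities of paths and cycles. -/

section Density

theorem sum_boolReal {N : ℕ} (f : Fin N → Bool) : ∑ a, boolReal (f a) = #{a | f a = true} := by
  simp [boolReal]

theorem cutDensity_path {N : ℕ} (hN : 1 ≤ N) :
    cutDensity (range (N - 1)) (pathCut N) = ((N : ℝ) - 1 / N) / 6 := by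
  -- `x` stands for `N`, kept free of `k = N - 1` so that induction on `k` works; cut `c` contains
  -- `c + 1` vertices.
  have hsum : ∀ (x : ℝ) (k : ℕ), ∑ c ∈ range k, ((c : ℝ) + 1) * (x - (c + 1)) =
      x * k * (k + 1) / 2 - k * (k + 1) * (2 * k + 1) / 6 := by
    intro x k
    induction k with
    | zero => simp
    | succ k ih =>
      rw [Finset.sum_range_succ, ih]
      push_cast
      ring
  have ht : ∀ c ∈ range (N - 1), ∑ a, boolReal (pathCut N c a) = (c : ℝ) + 1 := by
    intro c hc
    rw [mem_range] at hc
    rw [sum_boolReal]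
    have : ({a | pathCut N c a = true} : Finset (Fin N)) = Finset.Iic ⟨c, by omega⟩ := by
      ext a
      simp [pathCut, Fin.le_def]
    rw [this, Fin.card_Iic]
    push_cast
    rfl
  have hN0 : (N : ℝ) ≠ 0 := by positivity
  rw [cutDensity, ← Finset.sum_div, Fintype.card_fin,
    Finset.sum_congr rfl (g := fun c : ℕ => ((c : ℝ) + 1) * (N - (c + 1)))
      (fun c hc => by rw [ht c hc]), hsum, Nat.cast_sub hN]
  field_simp
  push_cast
  ring

theorem cutDensity_cycle {M N : ℕ} (hM : 1 ≤ M) (hN : N = 2 * M) :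
    cutDensity (range M) (cycleCut M N) = (N : ℝ) / 8 := by
  have ht : ∀ c ∈ range M, ∑ a, boolReal (cycleCut M N c a) = (M : ℝ) := by
    intro c hc
    rw [mem_range] at hc
    rw [sum_boolReal]
    have : ({a | cycleCut M N c a = true} : Finset (Fin N)) =
        Finset.Ico ⟨c, by omega⟩ ⟨c + M, by omega⟩ := by
      ext a
      simp [cycleCut, Fin.le_def, Fin.lt_def]
    rw [this, Fin.card_Ico]
    simp
  have hM0 : (M : ℝ) ≠ 0 := by positivity
  rw [cutDensity, ← Finset.sum_div, Fintype.card_fin,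
    Finset.sum_congr rfl (g := fun _ : ℕ => (M : ℝ) * (N - M)) (fun c hc => by rw [ht c hc]), hN]
  simp only [Finset.sum_const, card_range, nsmul_eq_mul]
  push_cast
  field_simp
  ring

end Density

/-! ### Optimal embeddings into the cylinder. -/

section Cylinder

variable {n : ℕ}

/-- The index set of the cuts of the factors of a cylinder. -/
def cylinderCutIndex (r : Fin n → ℕ) (i : Fin n) : Finset ℕ :=
  if i.val = 0 then range (2 ^ (r i - 1)) else range (2 ^ r i - 1)

/-- The cuts of the factors of a cylinder. -/
def cylinderCut (r : Fin n → ℕ) (i : Fin n) : ℕ → Fin (2 ^ r i) → Bool :=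
  if i.val = 0 then cycleCut (2 ^ (r i - 1)) (2 ^ r i) else pathCut (2 ^ r i)

theorem two_pow_eq_two_mul {k : ℕ} (hk : 1 ≤ k) : 2 ^ k = 2 * 2 ^ (k - 1) := by
  rw [← pow_succ', Nat.sub_add_cancel hk]

theorem isCutMetric_cylinder (r : Fin n → ℕ) (hr : ∀ i, 1 ≤ r i) (i : Fin n) :
    IsCutMetric
      (if i.val = 0 then SimpleGraph.cycleGraph (2 ^ r i) else SimpleGraph.pathGraph (2 ^ r i))
      (cylinderCutIndex r i) (cylinderCut r i) := by
  unfold cylinderCutIndex cylinderCut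
  split_ifs
  · exact isCutMetric_cycle Nat.one_le_two_pow (two_pow_eq_two_mul (hr i))
  · exact isCutMetric_path _

theorem cutDensity_cylinder (r : Fin n → ℕ) (hr : ∀ i, 1 ≤ r i) (i : Fin n) :
    cutDensity (cylinderCutIndex r i) (cylinderCut r i) =
      if i.val = 0 then (2 : ℝ) ^ r i / 8 else ((2 : ℝ) ^ r i - 1 / 2 ^ r i) / 6 := by
  unfold cylinderCutIndex cylinderCut
  split_ifs
  · rw [cutDensity_cycle Nat.one_le_two_pow (two_pow_eq_two_mul (hr i))]
    push_cast
    rfl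
  · rw [cutDensity_path Nat.one_le_two_pow]
    push_cast
    rfl

theorem exists_embedding_isLeast (r : Fin n → ℕ) (hr : ∀ i, 1 ≤ r i) {p q : ℕ}
    (hpq : ∑ i, r i = p + q) (hq : ∀ i, r i ≤ q) (hq0 : 0 < q) :
    ∃ f : Embedding (SimpleGraph.completeEquipartiteGraph (2 ^ p) (2 ^ q)) (cylinder r),
      (f.wirelength : ℝ) = (1 - 1 / 2 ^ p) * (2 ^ p * 2 ^ q) ^ 2 *
        ∑ i, cutDensity (cylinderCutIndex r i) (cylinderCut r i) ∧
      ∀ g : Embedding (SimpleGraph.completeEquipartiteGraph (2 ^ p) (2 ^ q)) (cylinder r),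
        f.wirelength ≤ g.wirelength := by
  classical
  have hcut := isCutMetric_cylinder r hr
  obtain ⟨φ, hφ, hb⟩ := exists_balanced r hpq hq hq0
  obtain ⟨f, hf⟩ := exists_embedding_of_injective
    (SimpleGraph.completeEquipartiteGraph (2 ^ p) (2 ^ q)) hcut hφ.injective
  have hadj : ∀ ξ : Fin (2 ^ p) × Fin (2 ^ q) → ∀ i, Fin (2 ^ r i),
      (∑ u, ∑ v, if (SimpleGraph.completeEquipartiteGraph (2 ^ p) (2 ^ q)).Adj u v then
        prodDist (cylinderCutIndex r) (cylinderCut r) (ξ u) (ξ v) else 0) =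
      ∑ u, ∑ v, if u.1 ≠ v.1 then
        prodDist (cylinderCutIndex r) (cylinderCut r) (ξ u) (ξ v) else 0 := by
    intro ξ
    simp only [SimpleGraph.completeEquipartiteGraph_adj]
  have hval := sum_prodDist_of_balanced (s := cylinderCutIndex r) (χ := cylinderCut r) hφ
    (by simpa only [Fintype.card_fin] using hb)
  rw [← hadj, ← hf] at hval
  simp only [Fintype.card_fin] at hval
  push_cast at hval
  have hfv := mul_left_cancel₀ two_ne_zero hval
  refine ⟨f, hfv, fun g => ?_⟩
  -- Equal cardinalities make every competing embedding bijective, so the lower bound applies to it.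
  have hg : Function.Bijective g.toFun := (Fintype.bijective_iff_injective_and_card _).mpr
    ⟨g.injective, by simp [Finset.prod_pow_eq_pow_sum, hpq, pow_add]⟩
  have hle := le_sum_prodDist (s := cylinderCutIndex r) (χ := cylinderCut r) hg
  rw [← hadj] at hle
  simp only [Fintype.card_fin] at hle
  have hle' : ((∑ u, ∑ v, if (SimpleGraph.completeEquipartiteGraph (2 ^ p) (2 ^ q)).Adj u v then
      prodDist (cylinderCutIndex r) (cylinderCut r) (g.toFun u) (g.toFun v) else 0 : ℕ) : ℝ) ≤
      ((2 * g.wirelength : ℕ) : ℝ) := by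
    exact_mod_cast sum_adj_prodDist_le _ hcut g
  have hfg := hle.trans hle'
  push_cast at hfg
  rw [← hfv] at hfg
  exact_mod_cast le_of_mul_le_mul_left hfg two_pos

theorem sum_cutDensity_cylinder (r : Fin n → ℕ) (hr : ∀ i, 1 ≤ r i) (hn : 0 < n) :
    ∑ i, cutDensity (cylinderCutIndex r i) (cylinderCut r i) =
      ((∑ i : Fin n with i.val ≠ 0, (2 : ℝ) ^ r i) -
        ∑ i : Fin n with i.val ≠ 0, 1 / (2 : ℝ) ^ r i) / 6 + (2 : ℝ) ^ r ⟨0, hn⟩ / 8 := by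
  simp only [cutDensity_cylinder r hr]
  rw [Finset.sum_ite, add_comm, ← Finset.sum_sub_distrib, Finset.sum_div]
  congr 1
  rw [show ({i : Fin n | i.val = 0} : Finset (Fin n)) = {⟨0, hn⟩} by
    ext i
    simp [Fin.ext_iff], Finset.sum_singleton]

end Cylinder

end GraphWirelength

theorem mainTheorem2 (n : ℕ) (hn : 3 ≤ n) (r : Fin n → ℕ) (hmono : Monotone r)
    (hr : ∀ i, 1 ≤ r i) (R : ℕ) (hR : ∑ i, r i = R) (p : ℕ) (hp : 1 ≤ p)
    (hpR : ∀ i, p + r i ≤ R) :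
    Nonempty (GraphWirelength.Embedding
      (SimpleGraph.completeEquipartiteGraph (2 ^ p) (2 ^ (R - p)))
      (GraphWirelength.cylinder r)) ∧
    (GraphWirelength.wirelength
      (SimpleGraph.completeEquipartiteGraph (2 ^ p) (2 ^ (R - p)))
      (GraphWirelength.cylinder r) : ℝ) =
      (2 : ℝ) ^ (2 * (R : ℤ) - (p : ℤ)) * ((2 : ℝ) ^ p - 1) / 6 *
        ((∑ i : Fin n with i.val ≠ 0, (2 : ℝ) ^ r i) -
          ∑ i : Fin n with i.val ≠ 0, 1 / (2 : ℝ) ^ r i) +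
      ((2 : ℝ) ^ p - 1) *
        (2 : ℝ) ^ (2 * (R : ℤ) + (r ⟨0, by omega⟩ : ℤ) - (p : ℤ) - 3) := by
  have h0 := hpR ⟨0, by omega⟩
  have h1 := hr ⟨0, by omega⟩
  obtain ⟨q, rfl⟩ : ∃ q, R = p + q := ⟨R - p, by omega⟩
  rw [Nat.add_sub_cancel_left]
  obtain ⟨f, hf, hmin⟩ := GraphWirelength.exists_embedding_isLeast r hr hR
    (fun i => by have := hpR i; omega) (by omega)
  have hw : GraphWirelength.wirelength
      (SimpleGraph.completeEquipartiteGraph (2 ^ p) (2 ^ q)) (GraphWirelength.cylinder r) =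
      f.wirelength :=
    IsLeast.csInf_eq ⟨⟨f, rfl⟩, by rintro _ ⟨g, rfl⟩; exact hmin g⟩
  refine ⟨⟨f⟩, ?_⟩
  rw [hw, hf, GraphWirelength.sum_cutDensity_cylinder r hr (by omega)]
  -- With `R = p + q` the exponent `2R - p` is `p + 2q`.
  have e1 : (2 : ℝ) ^ (2 * ((p + q : ℕ) : ℤ) - (p : ℤ)) = 2 ^ p * (2 ^ q) ^ 2 := by
    rw [show 2 * ((p + q : ℕ) : ℤ) - (p : ℤ) = ((p + 2 * q : ℕ) : ℤ) by push_cast; ring,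
      zpow_natCast]
    ring
  have e2 : (2 : ℝ) ^ (2 * ((p + q : ℕ) : ℤ) + (r ⟨0, by omega⟩ : ℤ) - (p : ℤ) - 3) =
      2 ^ p * (2 ^ q) ^ 2 * 2 ^ r ⟨0, by omega⟩ / 8 := by
    rw [show 2 * ((p + q : ℕ) : ℤ) + (r ⟨0, by omega⟩ : ℤ) - (p : ℤ) - 3 =
      ((p + 2 * q + r ⟨0, by omega⟩ : ℕ) : ℤ) - ((3 : ℕ) : ℤ) by push_cast; ring,
      zpow_sub₀ two_ne_zero, zpow_natCast, zpow_natCast]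
    ring
  rw [e1, e2]
  have hP : (2 : ℝ) ^ p ≠ 0 := by positivity
  have e3 : (1 - 1 / (2 : ℝ) ^ p) * (2 ^ p * 2 ^ q) ^ 2 = (2 ^ p - 1) * (2 ^ p * (2 ^ q) ^ 2) := by
    field_simp
  rw [e3]
  ring
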